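/- Let $n\ge 1$ and let $K_{1,n-1}$ be the star with centre $0$ and leaves $1,\dots,n-1$. A weighted Laplacian matrix of a graph $G$ on $n$ vertices is a real symmetric $n\times n$ matrix $A=[a_{i,j}]$ with $a_{i,j}<0$ if $\{i,j\}$ is an edge, $a_{i,j}=0$ if $i\ne j$ and $\{i,j\}$ is not an edge, and $a_{i,i}=-\sum_{k\sim i}a_{i,k}$; the set of these matrices is denoted $\mathcal{S}_L(G)$, and the weight of an edge $\{i,j\}$ is $-a_{i,j}$. Let $H=I-\frac1n J$, where $J$ is the $n\times n$ all-ones matrix, and let $\circ$ denote the entrywise product. A matrix $A\in\mathcal{S}_L(G)$ has the strong spectral property for weighted Laplacian matrices (SSPWL) if $X=O$ is the only real symmetric $n\times n$ matrix with $A\circ X=I\circ X=O$ and $H(AX-XA)H=O$. Let $A\in\mathcal{S}_L(K_{1,n-1})$ have edge weights $w_1,\dots,w_{n-1}$, where $w_i=-a_{0,i}$. Then $A$ has the SSPWL if and only if $w_1,\dots,w_{n-1}$ are pairwise distinct positive numbers. -/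

import Mathlib

open scoped Matrix

open Classical in
/-- The set of weighted Laplacian matrices of a finite simple graph `G`. -/
def weightedLaplacians {V : Type*} [Fintype V] (G : SimpleGraph V) :
    Set (Matrix V V ℝ) :=
  {A | A.IsSymm ∧
    (∀ i j, G.Adj i j → A i j < 0) ∧
    (∀ i j, i ≠ j → ¬ G.Adj i j → A i j = 0) ∧
    (∀ i, A i i = -∑ k with G.Adj i k, A i k)}

/-- The matrix `H = I - (1/n) J`, with `J` the all-ones matrix of order `n = |V|`. -/
noncomputable def centeringMatrix (V : Type*) [Fintype V] [DecidableEq V] : Matrix V V ℝ :=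
  1 - (1 / (Fintype.card V : ℝ)) • Matrix.of (fun _ _ => 1)

/-- The strong spectral property for weighted Laplacian matrices (SSPWL). -/
def HasSSPWL {V : Type*} [Fintype V] [DecidableEq V] (A : Matrix V V ℝ) : Prop :=
  ∀ X : Matrix V V ℝ, X.IsSymm → A ⊙ X = 0 → (1 : Matrix V V ℝ) ⊙ X = 0 →
    centeringMatrix V * (A * X - X * A) * centeringMatrix V = 0 → X = 0

/-! Double centering kills exactly the matrices `a i + b j`. The conditions on `X` confine it to
pairs of distinct leaves, so subtracting the centre's row and column of `A * X - X * A` leaves `(w i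
- w j) * x i j = u i - u j`, where `u` is the vector of weighted row sums of `x`. If the weights are
distinct, `x` consists of divided differences of `u`, and `u` is fixed by a divided-difference
operator. Interpolating `u` by a polynomial, this operator multiplies the leading coefficient in
degree `d` by `-d`, never by `1`; hence `u = 0`. If two weights agree, `x` is free inside that class
of leaves. This freedom absorbs one equation of the system for `u`, which then has a nonzero
solution. -/

/-- The double centering of `M` vanishes exactly when `M` is a sum of a function of the row and a
function of the column. -/
theorem centering_mul_mul_centering_eq_zero_iff {V : Type*} [Fintype V] [DecidableEq V] [Nonempty V]
    (M : Matrix V V ℝ) :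
    centeringMatrix V * M * centeringMatrix V = 0 ↔ ∃ a b : V → ℝ, ∀ i j, M i j = a i + b j := by
  have hc : (Fintype.card V : ℝ) ≠ 0 := by exact_mod_cast Fintype.card_ne_zero
  have entry : ∀ i j, (centeringMatrix V * M * centeringMatrix V) i j =
      M i j - (1 / (Fintype.card V : ℝ)) * ∑ k, M k j -
        ∑ l, (M i l - (1 / (Fintype.card V : ℝ)) * ∑ k, M k l) * (1 / (Fintype.card V : ℝ)) := by
    intro i j
    have left : ∀ l, (centeringMatrix V * M) i l =
        M i l - (1 / (Fintype.card V : ℝ)) * ∑ k, M k l := by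
      intro l
      rw [centeringMatrix, Matrix.sub_mul, Matrix.one_mul, Matrix.sub_apply, Matrix.smul_mul,
        Matrix.smul_apply, Matrix.mul_apply]
      simp
    rw [centeringMatrix, Matrix.mul_sub, Matrix.mul_one, Matrix.sub_apply, ← centeringMatrix, left]
    congr 1
    rw [Matrix.mul_apply]
    refine Finset.sum_congr rfl fun l _ => ?_
    rw [left]
    simp
  constructor
  · intro h
    refine ⟨fun i => ∑ l, (M i l - (1 / (Fintype.card V : ℝ)) * ∑ k, M k l) *
      (1 / (Fintype.card V : ℝ)), fun j => (1 / (Fintype.card V : ℝ)) * ∑ k, M k j, fun i j => ?_⟩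
    have := entry i j
    rw [h, Matrix.zero_apply] at this
    linarith
  · rintro ⟨a, b, h⟩
    ext i j
    rw [entry, Matrix.zero_apply]
    simp only [h, Finset.sum_add_distrib, Finset.sum_const, Finset.card_univ, nsmul_eq_mul,
      ← Finset.sum_mul, Finset.sum_sub_distrib, ← Finset.mul_sum]
    field_simp
    ring

/-! ### Distinct weights: divided differences of polynomials -/

open Polynomial in
/-- The operator `u ↦ (∑ k ≠ i, w k (u i - u k) / (w i - w k))` does not have the eigenvalue `1`:
on polynomial functions it is triangular with the eigenvalues `0, -1, -2, …`. -/
theorem eq_zero_of_divided_difference_eigenvector {m : ℕ} {w : Fin m → ℝ}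
    (hw : Function.Injective w) (u : Fin m → ℝ)
    (hu : ∀ i, u i = ∑ k, w k * ((u i - u k) / (w i - w k))) : u = 0 := by
  have hinj : Set.InjOn w (Finset.univ : Finset (Fin m)) := hw.injOn
  obtain ⟨p, peval, pdeg⟩ : ∃ p : ℝ[X], (∀ i, p.eval (w i) = u i) ∧ p.degree < m := by
    refine ⟨Lagrange.interpolate Finset.univ w u, fun i =>
      Lagrange.eval_interpolate_at_node u hinj (Finset.mem_univ i), ?_⟩
    have := Lagrange.degree_interpolate_lt u hinj
    rwa [Finset.card_univ, Fintype.card_fin] at this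
  suffices h0 : p = 0 by
    funext i
    rw [← peval, h0]
    simp
  by_contra hp0
  have hdiv : ∀ k, ∃ q : ℝ[X], (X - C (w k)) * q + C (u k) = p ∧ q.degree < p.degree := by
    intro k
    refine ⟨p /ₘ (X - C (w k)), ?_, ?_⟩
    · have := modByMonic_add_div p (X - C (w k))
      rw [modByMonic_X_sub_C_eq_C_eval, peval] at this
      rw [add_comm]
      exact this
    · have h0 : 0 < (X - C (w k)).degree := by
        rw [degree_X_sub_C]
        exact zero_lt_one
      exact degree_divByMonic_lt p (X - C (w k)) hp0 h0
  choose Q hQ Qdeg using hdiv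
  have Qeval : ∀ i k, i ≠ k → (Q k).eval (w i) = (u i - u k) / (w i - w k) := by
    intro i k hik
    have h := congrArg (eval (w i)) (hQ k)
    simp only [eval_add, eval_mul, eval_sub, eval_X, eval_C, peval] at h
    rw [eq_div_iff (sub_ne_zero.2 (hw.ne hik))]
    linarith
  have Qdiag : ∀ i, (Q i).eval (w i) = (derivative p).eval (w i) := by
    intro i
    have h := congrArg (fun q => (derivative q).eval (w i)) (hQ i)
    simpa using h
  -- `R` vanishes at the nodes by the equation for `u`. The term `X * derivative p` offsets the
  -- diagonal: the `k = i` quotient in `hu` is `0 / 0 = 0`, whereas `Q i` takes the value `p'` at `w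
  -- i`.
  let R : ℝ[X] := p - ∑ k, C (w k) * Q k + X * derivative p
  have Xdeg : (X * derivative p).degree ≤ p.degree := by
    rw [degree_le_iff_coeff_zero]
    intro j hj
    cases j with
    | zero => simp
    | succ j => rw [coeff_X_mul, coeff_derivative, coeff_eq_zero_of_degree_lt hj, zero_mul]
  have Rdeg : R.degree < m := by
    refine lt_of_le_of_lt ?_ pdeg
    refine (degree_add_le _ _).trans (max_le ((degree_sub_le _ _).trans (max_le le_rfl ?_)) Xdeg)
    refine (degree_sum_le _ _).trans (Finset.sup_le fun k _ => ?_)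
    rw [← smul_eq_C_mul]
    exact (degree_smul_le _ _).trans (Qdeg k).le
  have Reval : ∀ i, R.eval (w i) = 0 := by
    intro i
    have hs : ∑ k, w k * (Q k).eval (w i) = u i + w i * (derivative p).eval (w i) := by
      rw [hu i, ← Finset.add_sum_erase _ _ (Finset.mem_univ i),
        ← Finset.add_sum_erase _ (fun k => w k * ((u i - u k) / (w i - w k))) (Finset.mem_univ i),
        Qdiag, Finset.sum_congr rfl fun k hk => by rw [Qeval i k (Finset.ne_of_mem_erase hk).symm]]
      simp [add_comm]
    simp only [R, eval_add, eval_sub, eval_finsetSum, eval_mul, eval_C, eval_X, peval, hs]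
    ring
  have R0 : R = 0 :=
    eq_zero_of_degree_lt_of_eval_index_eq_zero Finset.univ hinj (by simpa using Rdeg)
      fun i _ => Reval i
  have hcoeff : R.coeff p.natDegree = (1 + p.natDegree) * p.leadingCoeff := by
    have h1 : ∀ k, (Q k).coeff p.natDegree = 0 := fun k =>
      coeff_eq_zero_of_degree_lt (by rw [← degree_eq_natDegree hp0]; exact Qdeg k)
    have h2 : (X * derivative p).coeff p.natDegree = p.natDegree * p.leadingCoeff := by
      rw [leadingCoeff]
      cases p.natDegree with
      | zero => simp
      | succ j =>
        rw [coeff_X_mul, coeff_derivative]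
        push_cast
        ring
    simp only [R, coeff_add, coeff_sub, finsetSum_coeff, coeff_C_mul, h1, h2, coeff_natDegree]
    simp
    ring
  rw [R0, coeff_zero] at hcoeff
  have : (1 + p.natDegree : ℝ) * p.leadingCoeff ≠ 0 :=
    mul_ne_zero (by positivity) (leadingCoeff_ne_zero.2 hp0)
  exact this hcoeff.symm

/-! ### Repeated weights: a nonzero solution -/

/-- If two of the positive weights `w` agree, there is a nonzero symmetric `x` with zero diagonal
such that `(w i - w j) x i j` is the difference of the weighted row sums of `x`. -/
theorem exists_ne_zero_of_weights_not_injective {m : ℕ} {w : Fin m → ℝ} (hpos : ∀ i, 0 < w i)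
    {a b : Fin m} (hab : a ≠ b) (hw : w a = w b) :
    ∃ x : Fin m → Fin m → ℝ, x ≠ 0 ∧ (∀ i j, x i j = x j i) ∧ (∀ i, x i i = 0) ∧
      ∀ i j, (w i - w j) * x i j = ∑ k, w k * x i k - ∑ k, w k * x j k := by
  classical
  let S := Set.range w
  let v : Fin m → S := fun i => ⟨w i, i, rfl⟩
  -- One unknown per distinct weight, and one equation for each except the repeated weight `w a`:
  -- the kernel is nonzero by dimension.
  let T : (S → ℝ) →ₗ[ℝ] ({s : S // s ≠ v a} → ℝ) :=
    { toFun := fun u s => u s - ∑ k, w k * ((u s - u (v k)) / (s - w k))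
      map_add' := by
        intro f g
        funext s
        simp only [Pi.add_apply]
        rw [← add_sub_add_comm, ← Finset.sum_add_distrib]
        congr 1
        refine Finset.sum_congr rfl fun k _ => ?_
        ring
      map_smul' := by
        intro c f
        funext s
        simp only [Pi.smul_apply, smul_eq_mul, RingHom.id_apply, mul_sub, Finset.mul_sum]
        congr 1
        refine Finset.sum_congr rfl fun k _ => ?_
        ring }
  have hker : LinearMap.ker T ≠ ⊥ := by
    apply LinearMap.ker_ne_bot_of_finrank_lt
    rw [Module.finrank_fintype_fun_eq_card, Module.finrank_fintype_fun_eq_card]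
    exact Fintype.card_subtype_lt (x := v a) (by simp)
  obtain ⟨u, huT, hu0⟩ := Submodule.exists_mem_ne_zero_of_ne_bot hker
  have hT : ∀ i, w i ≠ w a →
      ∑ k, w k * ((u (v i) - u (v k)) / (w i - w k)) = u (v i) := by
    intro i hi
    have h := congrFun (LinearMap.mem_ker.1 huT) ⟨v i, fun h => hi (congrArg Subtype.val h)⟩
    exact (sub_eq_zero.1 h).symm
  let N : ℝ := ((Finset.univ.filter fun k => w k = w a).card : ℝ) - 1
  have hN : N ≠ 0 := by
    have : 1 < (Finset.univ.filter fun k => w k = w a).card :=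
      Finset.one_lt_card.2 ⟨a, by simp, b, by simp [hw], hab⟩
    have : (1 : ℝ) < ((Finset.univ.filter fun k => w k = w a).card : ℝ) := by exact_mod_cast this
    exact (sub_pos.2 this).ne'
  -- In a row of the class of `a`, the constant `r` occurs `N` times with weight `w a`; this value
  -- restores the omitted equation.
  let r : ℝ := (u (v a) - ∑ k, w k * ((u (v a) - u (v k)) / (w a - w k))) / (N * w a)
  let x : Fin m → Fin m → ℝ := fun i j => (u (v i) - u (v j)) / (w i - w j) +
    if i ≠ j ∧ w i = w a ∧ w j = w a then r else 0
  have hv : ∀ i j, w i = w j → v i = v j := fun i j h => Subtype.ext h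
  have hrow : ∀ i, ∑ k, w k * x i k = u (v i) := by
    intro i
    simp only [x, mul_add, Finset.sum_add_distrib]
    by_cases hi : w i = w a
    · have h2 : ∑ k, w k * (if i ≠ k ∧ w i = w a ∧ w k = w a then r else 0) = N * w a * r := by
        have : ∀ k, w k * (if i ≠ k ∧ w i = w a ∧ w k = w a then r else 0) =
            (if w k = w a then w a * r else 0) - if i = k then w a * r else 0 := by
          intro k
          by_cases hk : w k = w a
          · by_cases hik : i = k <;> simp [hk, hik, hi]
          · have hik : i ≠ k := fun h => hk (h ▸ hi)
            simp [hk, hik]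
        simp only [this, Finset.sum_sub_distrib, ← Finset.sum_filter, Finset.sum_const,
          nsmul_eq_mul, N]
        rw [Finset.filter_eq, if_pos (Finset.mem_univ i), Finset.card_singleton]
        push_cast
        ring
      rw [h2, hv i a hi, hi, mul_div_cancel₀ _ (mul_ne_zero hN (hpos a).ne')]
      ring
    · simp [hi, hT i hi]
  refine ⟨x, ?_, ?_, ?_, ?_⟩
  · intro hx
    apply hu0
    funext ⟨s, i, hi⟩
    subst hi
    have := hrow i
    simp only [hx, Pi.zero_apply, mul_zero, Finset.sum_const_zero] at this
    exact this.symm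
  · intro i j
    simp only [x]
    rw [← neg_sub (u (v j)), ← neg_sub (w j), neg_div_neg_eq]
    congr 2
    rw [ne_comm, and_comm (a := w i = w a)]
  · intro i
    simp [x]
  · intro i j
    rw [hrow, hrow]
    by_cases hij : w i = w j
    · rw [hij, hv i j hij]
      simp
    · have : ¬ (i ≠ j ∧ w i = w a ∧ w j = w a) := fun h => hij (h.2.1.trans h.2.2.symm)
      simp only [x, if_neg this, add_zero]
      exact mul_div_cancel₀ _ (sub_ne_zero.2 hij)

/-! ### The equation for the star -/

/-- For a symmetric matrix supported on the leaves with zero diagonal, the SSPWL equation for a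
weighted star is a condition on the weighted row sums. -/
theorem star_sspwl_equation_iff {m : ℕ} {A X : Matrix (Fin 1 ⊕ Fin m) (Fin 1 ⊕ Fin m) ℝ}
    (hA : A ∈ weightedLaplacians (completeBipartiteGraph (Fin 1) (Fin m)))
    {w : Fin m → ℝ} (hw : ∀ i, A (Sum.inl 0) (Sum.inr i) = -w i) (hX : X.IsSymm)
    (hX0 : ∀ i, X (Sum.inl 0) i = 0) :
    centeringMatrix _ * (A * X - X * A) * centeringMatrix _ = 0 ↔
      ∀ i j, (w i - w j) * X (Sum.inr i) (Sum.inr j) =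
        ∑ k, w k * X (Sum.inr i) (Sum.inr k) - ∑ k, w k * X (Sum.inr j) (Sum.inr k) := by
  classical
  obtain ⟨hsymm, -, hzero, hdiag⟩ := hA
  have hX0' : ∀ i, X i (Sum.inl 0) = 0 := fun i => (hX.apply _ _).trans (hX0 i)
  have hw' : ∀ i, A (Sum.inr i) (Sum.inl 0) = -w i := fun i => (hsymm.apply _ _).trans (hw i)
  have hd : ∀ i, A (Sum.inr i) (Sum.inr i) = w i := by
    intro i
    rw [hdiag, Finset.sum_filter]
    simp [hw']
  have hleaf : ∀ i j, A (Sum.inr i) (Sum.inr j) = if i = j then w i else 0 := by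
    intro i j
    split_ifs with h
    · rw [← h, hd]
    · exact hzero _ _ (by simpa using h) (by simp)
  have K00 : (A * X - X * A) (Sum.inl 0) (Sum.inl 0) = 0 := by
    simp [Matrix.mul_apply, hX0, hX0']
  have K0r : ∀ j, (A * X - X * A) (Sum.inl 0) (Sum.inr j) =
      -∑ k, w k * X (Sum.inr j) (Sum.inr k) := by
    intro j
    simp [Matrix.mul_apply, hX0, hX0', hw, hX.apply (Sum.inr j)]
  have Kr0 : ∀ j, (A * X - X * A) (Sum.inr j) (Sum.inl 0) =
      ∑ k, w k * X (Sum.inr j) (Sum.inr k) := by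
    intro j
    simp [Matrix.mul_apply, hX0', hw', mul_comm]
  have Krr : ∀ i j, (A * X - X * A) (Sum.inr i) (Sum.inr j) =
      (w i - w j) * X (Sum.inr i) (Sum.inr j) := by
    intro i j
    simp [Matrix.mul_apply, hX0, hX0', hleaf]
    ring
  rw [centering_mul_mul_centering_eq_zero_iff]
  constructor
  · rintro ⟨a, b, h⟩ i j
    have h1 := h (Sum.inl 0) (Sum.inl 0)
    have h2 := h (Sum.inl 0) (Sum.inr j)
    have h3 := h (Sum.inr i) (Sum.inl 0)
    have h4 := h (Sum.inr i) (Sum.inr j)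
    rw [K00] at h1
    rw [K0r] at h2
    rw [Kr0] at h3
    rw [Krr] at h4
    linarith
  · intro h
    -- The centre's column and row serve as `a` and `b` because their common entry `K00` is zero.
    refine ⟨fun i => (A * X - X * A) i (Sum.inl 0), fun j => (A * X - X * A) (Sum.inl 0) j, ?_⟩
    rintro (i | i) (j | j) <;> beta_reduce
    · rw [Subsingleton.elim i 0, Subsingleton.elim j 0, K00, add_zero]
    · rw [Subsingleton.elim i 0, K00, zero_add]
    · rw [Subsingleton.elim j 0, K00, add_zero]
    · rw [Krr, Kr0, K0r, h, sub_eq_add_neg]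

theorem star_hasSSPWL_iff {m : ℕ} {A : Matrix (Fin 1 ⊕ Fin m) (Fin 1 ⊕ Fin m) ℝ}
    (hA : A ∈ weightedLaplacians (completeBipartiteGraph (Fin 1) (Fin m)))
    {w : Fin m → ℝ} (hw : ∀ i, A (Sum.inl 0) (Sum.inr i) = -w i) :
    HasSSPWL A ↔ (∀ i, 0 < w i) ∧ Function.Injective w := by
  have hpos : ∀ i, 0 < w i := by
    intro i
    have := hA.2.1 (Sum.inl 0) (Sum.inr i) (by simp)
    rw [hw] at this
    linarith
  constructor
  · refine fun h => ⟨hpos, fun a b hab => ?_⟩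
    by_contra hne
    obtain ⟨x, hx0, hxs, hxd, hx⟩ := exists_ne_zero_of_weights_not_injective hpos hne hab
    have hzero := h (Matrix.fromBlocks 0 0 0 (Matrix.of x)) ?_ ?_ ?_ ?_
    · apply hx0
      funext i j
      exact congrFun (congrFun hzero (Sum.inr i)) (Sum.inr j)
    · refine Matrix.IsSymm.fromBlocks (by simp) (by simp) ?_
      ext i j
      exact hxs j i
    · ext (i | i) (j | j)
      · simp
      · simp
      · simp
      · by_cases hij : i = j
        · simp [hij, hxd]
        · simp [hA.2.2.1 (Sum.inr i) (Sum.inr j) (by simpa using hij) (by simp)]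
    · ext (i | i) (j | j)
      · simp
      · simp
      · simp
      · by_cases hij : i = j
        · simp [hij, hxd]
        · simp [hij]
    · refine (star_sspwl_equation_iff hA hw ?_ ?_).2 hx
      · refine Matrix.IsSymm.fromBlocks (by simp) (by simp) ?_
        ext i j
        exact hxs j i
      · rintro (i | i) <;> simp
  · rintro ⟨-, hinj⟩ X hX hAX hIX hH
    have hdiag : ∀ i, X i i = 0 := by
      intro i
      simpa using congrFun (congrFun hIX i) i
    have hX0 : ∀ i, X (Sum.inl 0) i = 0 := by
      rintro (i | i)
      · rw [Subsingleton.elim i 0, hdiag]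
      · have := congrFun (congrFun hAX (Sum.inl 0)) (Sum.inr i)
        simpa [hw, (hpos i).ne'] using this
    have heq := (star_sspwl_equation_iff hA hw hX hX0).1 hH
    set u : Fin m → ℝ := fun i => ∑ k, w k * X (Sum.inr i) (Sum.inr k) with hu
    have hxu : ∀ i j, X (Sum.inr i) (Sum.inr j) = (u i - u j) / (w i - w j) := by
      intro i j
      by_cases hij : i = j
      · simp [hij, hdiag]
      · rw [eq_div_iff (sub_ne_zero.2 (hinj.ne hij)), mul_comm]
        exact heq i j
    -- Substituting `hxu` into the definition of `u` gives the fixed-point equation.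
    have hu0 : u = 0 := eq_zero_of_divided_difference_eigenvector hinj u fun i => by
      simp only [← hxu]
      rfl
    ext (i | i) (j | j)
    · rw [Subsingleton.elim i 0, hX0, Matrix.zero_apply]
    · rw [Subsingleton.elim i 0, hX0, Matrix.zero_apply]
    · rw [Subsingleton.elim j 0, hX.apply, hX0, Matrix.zero_apply]
    · rw [hxu, hu0]
      simp

theorem mainTheorem7 (n : ℕ) (hn : 1 ≤ n)
    (A : Matrix (Fin 1 ⊕ Fin (n - 1)) (Fin 1 ⊕ Fin (n - 1)) ℝ)
    (hA : A ∈ weightedLaplacians (completeBipartiteGraph (Fin 1) (Fin (n - 1))))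
    (w : Fin (n - 1) → ℝ)
    (hw : ∀ i, A (Sum.inl 0) (Sum.inr i) = -w i) :
    HasSSPWL A ↔ (∀ i, 0 < w i) ∧ Function.Injective w :=
  star_hasSSPWL_iff hA hw
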